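/- Let $d\ge 1$, let $\Omega\subseteq\mathbb R^d$ be open, let $\mu$ denote Lebesgue measure, and let $p:\Omega\to(0,\infty)$ be measurable with $0<p_-:=\operatorname{ess\,inf}_\Omega p$ and $p_+:=\operatorname{ess\,sup}_\Omega p<\infty$. Suppose there is $x_0\in\Omega$ with $p(x_0)=p_-$. For measurable $f$ on $\Omega$ (real- or complex-valued) put $$\|f\|_{p(\cdot)}=\inf\Big\{\lambda>0:\int_\Omega\Big(\frac{|f(x)|}{\lambda}\Big)^{p(x)}dx\le 1\Big\},\qquad f^*(t)=\inf\{s>0:\mu(\{|f|>s\})\le t\},$$ with $\inf\emptyset=\infty$; for $0<q<\infty$ put $\|f\|_{L_{p(\cdot),q}}=\big(\int_0^\infty u^q\|\chi_{\{|f|>u\}}\|_{p(\cdot)}^q\,\frac{du}{u}\big)^{1/q}$, and $\|f\|_{L_{p(\cdot),\infty}}=\sup_{u>0}u\,\|\chi_{\{|f|>u\}}\|_{p(\cdot)}$. For $0<r\le\infty$ let $L_r$ be the classical Lebesgue space, and let $L_{r,s}$ be the classical Lorentz space with quasi-norm $\|f\|_{L_{r,s}}=\big(\int_0^\infty (t^{1/r}f^*(t))^s\,\frac{dt}{t}\big)^{1/s}$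 if $0<s<\infty$ and $\|f\|_{L_{r,\infty}}=\sup_{t>0}t^{1/r}f^*(t)$ (where $1/\infty=0$). Each space consists of the measurable functions on $\Omega$ with finite quasi-norm. $X\hookrightarrow Y$ means that $X\subseteq Y$ and that there is a constant $C<\infty$ with $\|f\|_Y\le C\|f\|_X$ for all $f\in X$. Write $p\in LH_0\{x_1\}$ if there is $C_0>0$ with $|p(x)-p(x_1)|\le C_0/(-\log|x-x_1|)$ for all $x\in\Omega$ with $|x-x_1|<1/2$ (for $x=x_1$ the condition is void), and $p\in LH_0$ if $p\in LH_0\{x_1\}$ for every $x_1\in\Omega$. (A) If $p\in LH_0$, then for all $r$ with $p_-<r\le\infty$: 1. $L_{p(\cdot)}\not\hookrightarrow L_r$; 2. $L_{p(\cdot),q}\not\hookrightarrow L_{r,s}$ for all $0<q\le\infty$ and $0<s\le\infty$. (B) If $\mu(\Omega)<\infty$ and $p\in LH_0\{x_0\}$, then: 1. if $p_->1$, then $L_{p(\cdot)}(\Omega)\not\hookrightarrow L_{p_-,s}(\Omega)$ for all $0<s<p_-$; 2. if $1<q\le\infty$, then $L_{p(\cdot),q}(\Omega)\not\hookrightarrow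 L_{p_-,u}(\Omega)$ for all $0<u<q$. -/

import Mathlib

open MeasureTheory Set
open scoped ENNReal NNReal

noncomputable section

namespace VarLorentz

section Spaces

variable {α : Type*} [MeasurableSpace α] {𝕜 : Type*} [RCLike 𝕜]

/-- The essential infimum `p₋`, as an extended nonnegative number. -/
def pMinus (p : α → ℝ) (μ : Measure α) : ℝ≥0∞ :=
  essInf (fun x => ENNReal.ofReal (p x)) μ

/-- The essential supremum `p₊`, as an extended nonnegative number. -/
def pPlus (p : α → ℝ) (μ : Measure α) : ℝ≥0∞ :=
  essSup (fun x => ENNReal.ofReal (p x)) μ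

/-- Exponent functions (the class `𝒫`): measurable `p : α → (0, ∞)` with `p₋ > 0`. -/
structure IsExponent (p : α → ℝ) (μ : Measure α) : Prop where
  measurable : Measurable p
  pos : ∀ x, 0 < p x
  pMinus_pos : 0 < pMinus p μ

/-- The modular `∫ |f(x)|^{p(x)} dμ(x)`. -/
def modular (p : α → ℝ) (μ : Measure α) (f : α → 𝕜) : ℝ≥0∞ :=
  ∫⁻ x, ‖f x‖ₑ ^ p x ∂μ

/-- The Luxemburg quasi-norm `‖f‖_{p(·)} = inf {c > 0 : modular (f / c) ≤ 1}`, with `inf ∅ = ∞`. -/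
def varLpNorm (p : α → ℝ) (μ : Measure α) (f : α → 𝕜) : ℝ≥0∞ :=
  sInf {a | ∃ c : ℝ, 0 < c ∧ modular p μ (c⁻¹ • f) ≤ 1 ∧ a = ENNReal.ofReal c}

/-- `‖χ_{|f| > u}‖_{p(·)}`. -/
def levelNorm (p : α → ℝ) (μ : Measure α) (f : α → 𝕜) (u : ℝ) : ℝ≥0∞ :=
  varLpNorm p μ ({x | u < ‖f x‖}.indicator (fun _ => (1 : ℝ)))

/-- The quasi-norm of the variable Lorentz space `L_{p(·),q}`, `0 < q ≤ ∞`: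
`(∫₀^∞ u^q ‖χ_{|f| > u}‖_{p(·)}^q du/u)^{1/q}`, or `sup_{u > 0} u ‖χ_{|f| > u}‖_{p(·)}` if `q = ∞`. -/
def varLorentzNorm (p : α → ℝ) (q : ℝ≥0∞) (μ : Measure α) (f : α → 𝕜) : ℝ≥0∞ :=
  if q = ∞ then
    ⨆ u ∈ Ioi (0 : ℝ), ENNReal.ofReal u * levelNorm p μ f u
  else
    (∫⁻ u in Ioi (0 : ℝ),
      (ENNReal.ofReal u * levelNorm p μ f u) ^ q.toReal / ENNReal.ofReal u) ^ (1 / q.toReal)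

/-- The non-increasing rearrangement `f*(t) = inf {s > 0 : μ {|f| > s} ≤ t}`, with `inf ∅ = ∞`. -/
def rearrangement (μ : Measure α) (f : α → 𝕜) (t : ℝ) : ℝ≥0∞ :=
  sInf {a | ∃ s : ℝ, 0 < s ∧ μ {x | s < ‖f x‖} ≤ ENNReal.ofReal t ∧ a = ENNReal.ofReal s}

/-- The quasi-norm of the classical Lorentz space `L_{r,s}`, `0 < r, s ≤ ∞` (with `1/∞ = 0`):
`(∫₀^∞ (t^{1/r} f*(t))^s dt/t)^{1/s}`, or `sup_{t > 0} t^{1/r} f*(t)` if `s = ∞`. -/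
def lorentzNorm (r s : ℝ≥0∞) (μ : Measure α) (f : α → 𝕜) : ℝ≥0∞ :=
  if s = ∞ then
    ⨆ t ∈ Ioi (0 : ℝ), ENNReal.ofReal t ^ (r⁻¹).toReal * rearrangement μ f t
  else
    (∫⁻ t in Ioi (0 : ℝ),
      (ENNReal.ofReal t ^ (r⁻¹).toReal * rearrangement μ f t) ^ s.toReal /
        ENNReal.ofReal t) ^ (1 / s.toReal)

/-- The space of all measurable functions of finite quasi-norm `N`. -/
def funSpace (N : (α → 𝕜) → ℝ≥0∞) : Set (α → 𝕜) :=
  {f | Measurable f ∧ N f < ∞}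

/-- The continuous embedding `X ↪ Y` of the spaces with quasi-norms `N₁` and `N₂`:
`X ⊆ Y`, and the identity map from `X` to `Y` is bounded. -/
def Embeds (N₁ N₂ : (α → 𝕜) → ℝ≥0∞) : Prop :=
  funSpace N₁ ⊆ funSpace N₂ ∧ ∃ C : ℝ≥0, ∀ f ∈ funSpace N₁, N₂ f ≤ C * N₁ f

end Spaces

/-- Local log-Hölder continuity at the point `x₀` (the class `LH₀{x₀}`).
For `x = x₀` both sides of the inequality are zero. -/
def LogHolderAt {α : Type*} [PseudoMetricSpace α] (p : α → ℝ) (x₀ : α) : Prop :=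
  ∃ C₀ : ℝ, 0 < C₀ ∧ ∀ x, dist x x₀ < 1 / 2 → |p x - p x₀| ≤ C₀ / (-Real.log (dist x x₀))

/-- Local log-Hölder continuity (the class `LH₀`). -/
def LogHolder {α : Type*} [PseudoMetricSpace α] (p : α → ℝ) : Prop :=
  ∀ x₀, LogHolderAt p x₀

/-- Lebesgue measure on a subset `Ω` of `ℝ^d`. -/
def lebesgue {d : ℕ} (Ω : Set (EuclideanSpace ℝ (Fin d))) : Measure Ω :=
  Measure.comap Subtype.val volume

end VarLorentz

end

/-!
All four embeddings fail because of functions concentrated near `x₀`, where `p` attains its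
essential infimum `P = p x₀`. For `dist x x₀ ≤ ρ`, log-Hölder continuity at `x₀` bounds
`ρ ^ (-(p x - P))` by a constant (`LogOscillation.rpow_le`), so near `x₀` the modular behaves as
that of the constant exponent `P`. In particular the indicator function of the ball of radius `ρ`
has a quasi-norm at most `K ρ ^ (D / P)`, where `D` is the dimension
(`exists_varLpNorm_ball_le`); only this upper bound is needed.

If the first index `r` of the target exceeds `P`, the indicator functions themselves are test
functions: their target quasi-norm is at least of the order `ρ ^ (D / r)`, not dominated by
`ρ ^ (D / P)` as `ρ → 0` (`not_embeds_eLpNorm`, `not_embeds_lorentzNorm_of_lt`).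

If the first index is `P`, the test functions are the powers `dist x x₀ ^ (-D / P)`, truncated at a
distance `δ` from `x₀`. Their level sets are balls, and the integrands of both Lorentz quasi-norms
are comparable with `dt / t` on an interval of logarithmic length `≈ log (1 / δ)`. The
`L_{P, s}` quasi-norm is thus at least of the order `log (1 / δ) ^ (1 / s)`
(`le_lorentzNorm_truncPow`), whereas the `L_{p(·), q}` quasi-norm is at most of the order
`log (1 / δ) ^ (1 / q)` (`exists_varLorentzNorm_truncPow_le`) and the `L_{p(·)}` quasi-norm at most
of the order `log (1 / δ) ^ (1 / P)` (`exists_varLpNorm_truncPow_le`). As `δ → 0`, no constant in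
the embedding is large enough if `s < q`, respectively `s < P`
(`not_embeds_lorentzNorm_of_log_growth`).

The argument uses only that balls of small radius `ρ` around `x₀` have the measure `v ρ ^ D`, and
is carried out in metric measure spaces with this property.
-/

namespace VarLorentz

/-! ### Integrals against `dt / t` -/

theorem lintegral_ofReal_inv_Ioc {a b : ℝ} (ha : 0 < a) (hab : a ≤ b) :
    ∫⁻ t in Ioc a b, ENNReal.ofReal t⁻¹ = ENNReal.ofReal (Real.log (b / a)) := by
  have h0 : (0 : ℝ) ∉ uIcc a b := by
    rw [uIcc_of_le hab]
    exact fun h => absurd h.1 (not_le.2 ha)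
  have hi : IntervalIntegrable (fun t : ℝ => t⁻¹) volume a b :=
    intervalIntegral.intervalIntegrable_inv (fun x hx h => h0 (h ▸ hx)) continuousOn_id
  rw [← integral_inv h0, intervalIntegral.integral_of_le hab,
    ofReal_integral_eq_lintegral_ofReal]
  · exact (intervalIntegrable_iff_integrableOn_Ioc_of_le hab).1 hi
  · exact (ae_restrict_iff' measurableSet_Ioc).2
      (Filter.Eventually.of_forall fun t ht => (inv_pos.2 (ha.trans ht.1)).le)

theorem lintegral_ofReal_rpow_Ioc {q : ℝ} (hq : 0 < q) :
    ∫⁻ t in Ioc (0 : ℝ) 1, ENNReal.ofReal (t ^ (q - 1)) = ENNReal.ofReal (1 / q) := by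
  have hi : IntervalIntegrable (fun t : ℝ => t ^ (q - 1)) volume 0 1 :=
    intervalIntegral.intervalIntegrable_rpow' (by linarith)
  have hv : ∫ t in (0 : ℝ)..1, t ^ (q - 1) = 1 / q := by
    rw [integral_rpow (Or.inl (by linarith))]
    simp [hq.ne']
  rw [← hv, intervalIntegral.integral_of_le zero_le_one, ofReal_integral_eq_lintegral_ofReal]
  · exact (intervalIntegrable_iff_integrableOn_Ioc_of_le zero_le_one).1 hi
  · exact (ae_restrict_iff' measurableSet_Ioc).2
      (Filter.Eventually.of_forall fun t ht => Real.rpow_nonneg ht.1.le _)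

/-- A quantity dominated by `min t 1` and supported in `t < N` has a `q`-th power whose integral
against `dt / t` grows only like `log N`. -/
theorem lintegral_rpow_div_le {F : ℝ → ℝ≥0∞} {A N q : ℝ} (hq : 0 < q) (hA : 0 ≤ A) (hN : 1 ≤ N)
    (hF : ∀ t, 0 < t → F t ≤ ENNReal.ofReal (A * min t 1)) (hF0 : ∀ t, N ≤ t → F t = 0) :
    ∫⁻ t in Ioi (0 : ℝ), F t ^ q / ENNReal.ofReal t ≤
      ENNReal.ofReal (A ^ q * (1 / q + Real.log N)) := by
  have hAq : 0 ≤ A ^ q := Real.rpow_nonneg hA q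
  have hsub : Ioi (0 : ℝ) ⊆ (Ioc 0 1 ∪ Ioc 1 N) ∪ Ioi N := by
    rw [Ioc_union_Ioc_eq_Ioc zero_le_one hN, Ioc_union_Ioi_eq_Ioi (zero_le_one.trans hN)]
  have h1 : ∫⁻ t in Ioc (0 : ℝ) 1, F t ^ q / ENNReal.ofReal t ≤
      ENNReal.ofReal (A ^ q) * ENNReal.ofReal (1 / q) := by
    rw [← lintegral_ofReal_rpow_Ioc hq, ← lintegral_const_mul' _ _ ENNReal.ofReal_ne_top]
    refine setLIntegral_mono' measurableSet_Ioc fun t ht => ?_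
    refine ENNReal.div_le_of_le_mul ?_
    rw [← ENNReal.ofReal_mul hAq, ← ENNReal.ofReal_mul (by have := ht.1; positivity)]
    refine (ENNReal.rpow_le_rpow (hF t ht.1) hq.le).trans ?_
    rw [ENNReal.ofReal_rpow_of_nonneg (mul_nonneg hA (le_min ht.1.le zero_le_one)) hq.le,
      min_eq_left ht.2, Real.mul_rpow hA ht.1.le, mul_assoc, Real.rpow_sub_one ht.1.ne',
      div_mul_cancel₀ _ ht.1.ne']
  have h2 : ∫⁻ t in Ioc (1 : ℝ) N, F t ^ q / ENNReal.ofReal t ≤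
      ENNReal.ofReal (A ^ q) * ENNReal.ofReal (Real.log N) := by
    have := lintegral_ofReal_inv_Ioc zero_lt_one hN
    rw [div_one] at this
    rw [← this, ← lintegral_const_mul' _ _ ENNReal.ofReal_ne_top]
    refine setLIntegral_mono' measurableSet_Ioc fun t ht => ?_
    have ht0 : 0 < t := zero_lt_one.trans ht.1
    refine ENNReal.div_le_of_le_mul ?_
    rw [← ENNReal.ofReal_mul hAq, ← ENNReal.ofReal_mul (by positivity)]
    refine (ENNReal.rpow_le_rpow (hF t ht0) hq.le).trans ?_
    rw [ENNReal.ofReal_rpow_of_nonneg (mul_nonneg hA (le_min ht0.le zero_le_one)) hq.le,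
      min_eq_right ht.1.le, mul_one, mul_assoc, inv_mul_cancel₀ ht0.ne', mul_one]
  have h3 : ∫⁻ t in Ioi N, F t ^ q / ENNReal.ofReal t = 0 := by
    rw [setLIntegral_congr_fun measurableSet_Ioi (g := fun _ => 0)]
    · simp
    · intro t ht
      simp [hF0 t (le_of_lt ht), hq]
  calc _ ≤ _ := lintegral_mono_set hsub
    _ ≤ _ := lintegral_union_le _ _ _
    _ ≤ _ := add_le_add (lintegral_union_le _ _ _) h3.le
    _ ≤ _ := by
      rw [add_zero, mul_add, ENNReal.ofReal_add (by positivity)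
        (mul_nonneg hAq (Real.log_nonneg hN)), ENNReal.ofReal_mul hAq, ENNReal.ofReal_mul hAq]
      exact add_le_add h1 h2

/-! ### General estimates of the quasi-norms -/

section Norms

variable {α : Type*} [MeasurableSpace α] {𝕜 : Type*} [RCLike 𝕜] {p : α → ℝ} {μ : Measure α}

theorem varLpNorm_le {f : α → 𝕜} {c : ℝ} (hc : 0 < c) (h : modular p μ (c⁻¹ • f) ≤ 1) :
    varLpNorm p μ f ≤ ENNReal.ofReal c :=
  sInf_le ⟨c, hc, h, rfl⟩

theorem varLpNorm_mono {𝕜' : Type*} [RCLike 𝕜'] (hp : ∀ x, 0 < p x) {f : α → 𝕜} {g : α → 𝕜'}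
    (h : ∀ x, ‖f x‖ ≤ ‖g x‖) : varLpNorm p μ f ≤ varLpNorm p μ g := by
  refine sInf_le_sInf ?_
  rintro _ ⟨c, hc, hm, rfl⟩
  refine ⟨c, hc, le_trans (lintegral_mono fun x => ?_) hm, rfl⟩
  refine ENNReal.rpow_le_rpow ?_ (hp x).le
  rw [enorm_le_iff_norm_le, Pi.smul_apply, Pi.smul_apply, norm_smul, norm_smul]
  exact mul_le_mul_of_nonneg_left (h x) (norm_nonneg _)

theorem varLpNorm_zero (hp : ∀ x, 0 < p x) : varLpNorm p μ (fun _ => (0 : 𝕜)) = 0 := by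
  refine le_antisymm (ENNReal.le_of_forall_pos_le_add fun ε hε _ => ?_) zero_le
  have := varLpNorm_le (p := p) (μ := μ) (f := fun _ => (0 : 𝕜)) (c := ε) hε (by
    simp [modular, hp])
  simpa using this

theorem levelNorm_eq_zero (hp : ∀ x, 0 < p x) {f : α → 𝕜} {u : ℝ} (h : ∀ x, ‖f x‖ ≤ u) :
    levelNorm p μ f u = 0 := by
  have : {x | u < ‖f x‖} = ∅ := by
    ext x
    simpa using h x
  rw [levelNorm, this, indicator_empty]
  exact varLpNorm_zero hp

theorem levelNorm_le_of_subset (hp : ∀ x, 0 < p x) {f : α → 𝕜} {u : ℝ} {S : Set α}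
    (h : {x | u < ‖f x‖} ⊆ S) :
    levelNorm p μ f u ≤ varLpNorm p μ (S.indicator fun _ => (1 : ℝ)) :=
  varLpNorm_mono hp fun _ => norm_indicator_le_of_subset h _ _

/-- For `q = ∞` the exponent `1 / q.toReal` is `1 / 0 = 0`, so that the bound reads `A`. -/
theorem varLorentzNorm_le (hp : ∀ x, 0 < p x) {f : α → 𝕜} {q : ℝ≥0∞} (hq : 0 < q) {A N : ℝ}
    (hA : 0 ≤ A) (hN : 1 ≤ N) (hfN : ∀ x, ‖f x‖ ≤ N)
    (hf : ∀ u, 0 < u → ENNReal.ofReal u * levelNorm p μ f u ≤ ENNReal.ofReal (A * min u 1)) :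
    varLorentzNorm p q μ f ≤
      ENNReal.ofReal (A * (1 / q.toReal + Real.log N) ^ (1 / q.toReal)) := by
  unfold varLorentzNorm
  split_ifs with h
  · subst h
    simp only [ENNReal.toReal_top, div_zero, Real.rpow_zero, mul_one]
    refine iSup₂_le fun u hu => (hf u hu).trans (ENNReal.ofReal_le_ofReal ?_)
    exact mul_le_of_le_one_right hA (min_le_right _ _)
  · have hq' : 0 < q.toReal := ENNReal.toReal_pos hq.ne' h
    have hl : 0 ≤ 1 / q.toReal + Real.log N := add_nonneg (by positivity) (Real.log_nonneg hN)
    refine (ENNReal.rpow_le_rpow (lintegral_rpow_div_le hq' hA hN hf fun t ht => ?_)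
      (by positivity)).trans ?_
    · rw [levelNorm_eq_zero hp fun x => (hfN x).trans ht, mul_zero]
    · rw [ENNReal.ofReal_rpow_of_nonneg (mul_nonneg (Real.rpow_nonneg hA _) hl) (by positivity),
        Real.mul_rpow (Real.rpow_nonneg hA _) hl, ← Real.rpow_mul hA, mul_one_div_cancel hq'.ne',
        Real.rpow_one]

theorem le_rearrangement {f : α → 𝕜} {s t : ℝ}
    (h : ∀ σ, 0 < σ → σ < s → ENNReal.ofReal t < μ {x | σ < ‖f x‖}) :
    ENNReal.ofReal s ≤ rearrangement μ f t := by
  refine le_sInf ?_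
  rintro _ ⟨σ, hσ, hm, rfl⟩
  refine ENNReal.ofReal_le_ofReal (not_lt.1 fun hlt => ?_)
  exact absurd hm (not_le.2 (h σ hσ hlt))

/-- For `s = ∞` the exponent `1 / s.toReal` is `1 / 0 = 0`, so that the bound reads `A`. -/
theorem le_lorentzNorm {f : α → 𝕜} {r s : ℝ≥0∞} (hs : 0 < s) {A a b : ℝ} (hA : 0 ≤ A)
    (ha : 0 < a) (hab : a < b)
    (hf : ∀ t, a < t → t < b →
      ENNReal.ofReal A ≤ ENNReal.ofReal t ^ (r⁻¹).toReal * rearrangement μ f t) :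
    ENNReal.ofReal (A * Real.log (b / a) ^ (1 / s.toReal)) ≤ lorentzNorm r s μ f := by
  unfold lorentzNorm
  split_ifs with h
  · subst h
    simp only [ENNReal.toReal_top, div_zero, Real.rpow_zero, mul_one]
    obtain ⟨t, h1, h2⟩ := exists_between hab
    exact (hf t h1 h2).trans (le_iSup₂_of_le t (ha.trans h1) le_rfl)
  · have hs' : 0 < s.toReal := ENNReal.toReal_pos hs.ne' h
    have hl : 0 ≤ Real.log (b / a) := Real.log_nonneg ((one_le_div ha).2 hab.le)
    have hAs : 0 ≤ A ^ s.toReal := Real.rpow_nonneg hA _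
    have key : ENNReal.ofReal (A ^ s.toReal * Real.log (b / a)) ≤
        ∫⁻ t in Ioi (0 : ℝ), (ENNReal.ofReal t ^ (r⁻¹).toReal * rearrangement μ f t) ^ s.toReal /
          ENNReal.ofReal t := by
      rw [ENNReal.ofReal_mul hAs, ← lintegral_ofReal_inv_Ioc ha hab.le,
        ← lintegral_const_mul' _ _ ENNReal.ofReal_ne_top, ← setLIntegral_congr Ioo_ae_eq_Ioc]
      refine (setLIntegral_mono' measurableSet_Ioo fun t ht => ?_).trans
        (lintegral_mono_set fun t ht => ha.trans ht.1)
      rw [ENNReal.ofReal_inv_of_pos (ha.trans ht.1), ← div_eq_mul_inv,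
        ← ENNReal.ofReal_rpow_of_nonneg hA hs'.le]
      gcongr
      exact hf t ht.1 ht.2
    refine le_trans (le_of_eq ?_) (ENNReal.rpow_le_rpow key (by positivity))
    rw [ENNReal.ofReal_rpow_of_nonneg (mul_nonneg hAs hl) (by positivity),
      Real.mul_rpow hAs hl, ← Real.rpow_mul hA, mul_one_div_cancel hs'.ne', Real.rpow_one]

/-- A continuous embedding, as an inequality between real bounds of the two quasi-norms. -/
theorem Embeds.exists_real_bound {N₁ N₂ : (α → 𝕜) → ℝ≥0∞} (h : Embeds N₁ N₂) :
    ∃ C : ℝ, 0 ≤ C ∧ ∀ (f : α → 𝕜) (a b : ℝ), Measurable f → 0 ≤ b →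
      N₁ f ≤ ENNReal.ofReal b → ENNReal.ofReal a ≤ N₂ f → a ≤ C * b := by
  obtain ⟨-, C, hC⟩ := h
  refine ⟨C, C.2, fun f a b hf hb h1 h2 => ?_⟩
  have h3 := h2.trans ((hC f ⟨hf, h1.trans_lt ENNReal.ofReal_lt_top⟩).trans
    (mul_le_mul_right h1 _))
  rwa [← ENNReal.ofReal_coe_nnreal, ← ENNReal.ofReal_mul (NNReal.coe_nonneg C),
    ENNReal.ofReal_le_ofReal_iff (mul_nonneg (NNReal.coe_nonneg C) hb)] at h3

end Norms

/-! ### Growth comparisons -/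

/-- A larger power of `ρ` cannot dominate a smaller one as `ρ → 0`. -/
theorem not_forall_rpow_le_of_lt {A B R a b : ℝ} (hA : 0 < A) (hR : 0 < R) (hab : a < b) :
    ¬ ∀ ρ, 0 < ρ → ρ ≤ R → A * ρ ^ a ≤ B * ρ ^ b := by
  intro h
  have ht : Filter.Tendsto (fun ρ : ℝ => B * ρ ^ (b - a)) (nhdsWithin 0 (Ioi 0)) (nhds 0) := by
    have := (Real.continuousAt_rpow_const 0 (b - a) (Or.inr (sub_pos.2 hab).le)).tendsto
    rw [Real.zero_rpow (sub_pos.2 hab).ne'] at this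
    simpa using (this.mono_left nhdsWithin_le_nhds).const_mul B
  refine absurd (ge_of_tendsto ht ?_) (not_le.2 hA)
  filter_upwards [Ioc_mem_nhdsGT hR] with ρ hρ
  have := h ρ hρ.1 hρ.2
  rw [Real.rpow_sub hρ.1, mul_div_assoc', le_div_iff₀ (Real.rpow_pos_of_pos hρ.1 a)]
  exact this

/-- A smaller power of an affine function of `y` cannot dominate a larger power of `y`
as `y → ∞`. -/
theorem not_forall_rpow_le_affine_rpow {A B c k y₀ α β : ℝ} (hA : 0 < A) (hB : 0 ≤ B) (hc : 0 ≤ c)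
    (hk : 0 ≤ k) (hβ : 0 ≤ β) (hαβ : β < α) :
    ¬ ∀ y, y₀ ≤ y → A * y ^ α ≤ B * (c + k * y) ^ β := by
  intro h
  obtain ⟨y, hy⟩ := ((((tendsto_rpow_atTop (sub_pos.2 hαβ)).eventually_gt_atTop
    (B * (c + k) ^ β / A))).and ((Filter.eventually_ge_atTop 1).and
      (Filter.eventually_ge_atTop y₀))).exists
  obtain ⟨h1, h2, h3⟩ := hy
  have hy0 : 0 < y := by linarith
  have h4 : (c + k * y) ^ β ≤ (c + k) ^ β * y ^ β := by
    rw [← Real.mul_rpow (by positivity) hy0.le]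
    refine Real.rpow_le_rpow (by positivity) ?_ hβ
    nlinarith [mul_nonneg hc (sub_nonneg.2 h2)]
  have h5 := (h y h3).trans (mul_le_mul_of_nonneg_left h4 hB)
  rw [Real.rpow_sub hy0, div_lt_div_iff₀ hA (Real.rpow_pos_of_pos hy0 β)] at h1
  nlinarith

/-! ### The exponent near its minimum point -/

/-- The balls around `x₀` of radius at most `R` have the measure `v ρ ^ D`. -/
def BallVolume {α : Type*} [PseudoMetricSpace α] [MeasurableSpace α] (μ : Measure α) (x₀ : α)
    (v D R : ℝ) : Prop :=
  ∀ ρ, 0 < ρ → ρ ≤ R → μ (Metric.ball x₀ ρ) = ENNReal.ofReal (v * ρ ^ D)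

/-- In the closed ball of radius `ρ` around `x₀`, where `ρ ≤ R`, the exponent `p` exceeds
`p x₀` by at most `C₀ / log (1 / ρ)`. -/
def LogOscillation {α : Type*} [PseudoMetricSpace α] (p : α → ℝ) (x₀ : α) (C₀ R : ℝ) : Prop :=
  ∀ ρ x, 0 < ρ → ρ ≤ R → dist x x₀ ≤ ρ → -Real.log ρ * (p x - p x₀) ≤ C₀

section Local

variable {α : Type*} [PseudoMetricSpace α] {p : α → ℝ} {x₀ : α} {v D R C₀ : ℝ}

theorem LogHolderAt.exists_logOscillation (h : LogHolderAt p x₀) :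
    ∃ C₀, ∀ R < 1 / 2, LogOscillation p x₀ C₀ R := by
  obtain ⟨C, hC, h⟩ := h
  refine ⟨C, fun R hR ρ x hρ hρR hx => ?_⟩
  have hl : 0 < -Real.log ρ := neg_pos.2 (Real.log_neg hρ (by linarith))
  have h1 : p x - p x₀ ≤ C / (-Real.log (dist x x₀)) :=
    (le_abs_self _).trans (h x (by linarith))
  rw [mul_comm, ← le_div_iff₀ hl]
  refine h1.trans ?_
  rcases (dist_nonneg (x := x) (y := x₀)).eq_or_lt with h0 | h0
  · rw [← h0]
    simp only [Real.log_zero, neg_zero, div_zero]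
    positivity
  · exact div_le_div_of_nonneg_left hC.le hl (neg_le_neg (Real.log_le_log h0 hx))

/-- Log-Hölder continuity allows the variable exponent of a power of the radius to be replaced by
its value at the centre, at the cost of a constant. -/
theorem LogOscillation.rpow_le (h : LogOscillation p x₀ C₀ R) {ρ a : ℝ} {x : α} (hρ : 0 < ρ)
    (hρR : ρ ≤ R) (ha : 0 ≤ a) (hx : dist x x₀ ≤ ρ) :
    ρ ^ (-a * p x) ≤ Real.exp (a * C₀) * ρ ^ (-a * p x₀) := by
  rw [Real.rpow_def_of_pos hρ, Real.rpow_def_of_pos hρ, ← Real.exp_add, Real.exp_le_exp]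
  nlinarith [mul_le_mul_of_nonneg_left (h ρ x hρ hρR hx) ha]

variable [MeasurableSpace α] [OpensMeasurableSpace α] {μ : Measure α} {𝕜 : Type*} [RCLike 𝕜]

theorem exists_varLpNorm_ball_le (hp : ∀ x, 0 < p x) (hP : ∀ᵐ x ∂μ, p x₀ ≤ p x)
    (hD : 0 < D) (hμ : BallVolume μ x₀ v D R) (h : LogOscillation p x₀ C₀ R) :
    ∃ K : ℝ, 0 < K ∧ ∀ ρ, 0 < ρ → ρ ≤ R →
      varLpNorm p μ ((Metric.ball x₀ ρ).indicator fun _ => (1 : 𝕜)) ≤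
        ENNReal.ofReal (K * ρ ^ (D / p x₀)) := by
  have hP0 := hp x₀
  set M : ℝ := max 1 (v * Real.exp (D / p x₀ * C₀))
  have hM1 : 1 ≤ M := le_max_left _ _
  have hM0 : 0 < M := zero_lt_one.trans_le hM1
  refine ⟨M ^ (1 / p x₀), Real.rpow_pos_of_pos hM0 _, fun ρ hρ hρR => ?_⟩
  set c := M ^ (1 / p x₀) * ρ ^ (D / p x₀) with hc
  have hc0 : 0 < c := mul_pos (Real.rpow_pos_of_pos hM0 _) (Real.rpow_pos_of_pos hρ _)
  refine varLpNorm_le hc0 ?_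
  have hint : ∀ᵐ x ∂μ, ‖(c⁻¹ • (Metric.ball x₀ ρ).indicator fun _ => (1 : 𝕜)) x‖ₑ ^ p x ≤
      (Metric.ball x₀ ρ).indicator
        (fun _ => ENNReal.ofReal (M⁻¹ * (Real.exp (D / p x₀ * C₀) * ρ ^ (-D)))) x := by
    filter_upwards [hP] with x hx
    by_cases hxb : x ∈ Metric.ball x₀ ρ
    · rw [Pi.smul_apply, indicator_of_mem hxb, indicator_of_mem hxb, enorm_smul, enorm_one, mul_one,
        Real.enorm_of_nonneg (inv_pos.2 hc0).le,
        ENNReal.ofReal_rpow_of_nonneg (inv_pos.2 hc0).le (hp x).le]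
      refine ENNReal.ofReal_le_ofReal ?_
      rw [hc, mul_inv, Real.mul_rpow (by positivity) (by positivity)]
      refine mul_le_mul ?_ ?_ (by positivity) (by positivity)
      · rw [← Real.rpow_neg hM0.le, ← Real.rpow_mul hM0.le, ← Real.rpow_neg_one M]
        refine Real.rpow_le_rpow_of_exponent_le hM1 ?_
        rw [neg_mul, neg_le_neg_iff, one_div, inv_mul_eq_div, one_le_div hP0]
        exact hx
      · have := h.rpow_le hρ hρR (a := D / p x₀) (by positivity) (Metric.mem_ball.1 hxb).le
        rw [← Real.rpow_neg hρ.le, ← Real.rpow_mul hρ.le]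
        refine this.trans (le_of_eq ?_)
        rw [neg_mul, div_mul_cancel₀ _ hP0.ne']
    · rw [Pi.smul_apply, indicator_of_notMem hxb, indicator_of_notMem hxb]
      simp [hp x]
  refine (lintegral_mono_ae hint).trans ?_
  rw [lintegral_indicator_const Metric.isOpen_ball.measurableSet, hμ ρ hρ hρR,
    ← ENNReal.ofReal_mul (by positivity), ENNReal.ofReal_le_one]
  have e : M⁻¹ * (Real.exp (D / p x₀ * C₀) * ρ ^ (-D)) * (v * ρ ^ D) =
      M⁻¹ * (v * Real.exp (D / p x₀ * C₀)) * (ρ ^ (-D) * ρ ^ D) := by ring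
  rw [e, ← Real.rpow_add hρ, neg_add_cancel, Real.rpow_zero, mul_one, inv_mul_le_one₀ hM0]
  exact le_max_right _ _

/-! ### Failure of the embeddings into spaces with a larger first index -/

theorem measurable_indicator_ball (x₀ : α) (ρ : ℝ) :
    Measurable ((Metric.ball x₀ ρ).indicator fun _ => (1 : 𝕜)) :=
  measurable_const.indicator Metric.isOpen_ball.measurableSet

theorem not_embeds_eLpNorm (hp : ∀ x, 0 < p x) (hP : ∀ᵐ x ∂μ, p x₀ ≤ p x) (hD : 0 < D)
    (hv : 0 < v) (hR : 0 < R) (hμ : BallVolume μ x₀ v D R) (h : LogOscillation p x₀ C₀ R)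
    {r : ℝ≥0∞} (hr : r ≠ 0) (hrp : 1 / r.toReal < 1 / p x₀) :
    ¬ Embeds (𝕜 := 𝕜) (varLpNorm p μ) (fun f => eLpNorm f r μ) := by
  intro hE
  obtain ⟨C, hC0, hC⟩ := hE.exists_real_bound
  obtain ⟨K, hK, hKb⟩ := exists_varLpNorm_ball_le (𝕜 := 𝕜) hp hP hD hμ h
  refine not_forall_rpow_le_of_lt (A := v ^ (1 / r.toReal)) (B := C * K) (R := R)
    (a := D * (1 / r.toReal)) (b := D * (1 / p x₀)) (Real.rpow_pos_of_pos hv _) hR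
    (mul_lt_mul_of_pos_left hrp hD) fun ρ hρ hρR => ?_
  have hV : 0 < v * ρ ^ D := mul_pos hv (Real.rpow_pos_of_pos hρ _)
  have h1 := hC _ ((v * ρ ^ D) ^ (1 / r.toReal)) _ (measurable_indicator_ball x₀ ρ)
    (by positivity) (hKb ρ hρ hρR) (by
      rw [eLpNorm_indicator_const' Metric.isOpen_ball.measurableSet
        (by simp [hμ ρ hρ hρR, hV]) hr, enorm_one, one_mul, hμ ρ hρ hρR,
        ENNReal.ofReal_rpow_of_nonneg hV.le (by positivity)])
  rw [Real.mul_rpow hv.le (by positivity), ← Real.rpow_mul hρ.le] at h1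
  rwa [mul_one_div D (p x₀), mul_assoc]

theorem not_embeds_lorentzNorm_of_lt (hp : ∀ x, 0 < p x) (hP : ∀ᵐ x ∂μ, p x₀ ≤ p x) (hD : 0 < D)
    (hv : 0 < v) (hR : 0 < R) (hμ : BallVolume μ x₀ v D R) (h : LogOscillation p x₀ C₀ R)
    {r q s : ℝ≥0∞} (hq : 0 < q) (hs : 0 < s) (hrp : (r⁻¹).toReal < 1 / p x₀) :
    ¬ Embeds (𝕜 := 𝕜) (varLorentzNorm p q μ) (lorentzNorm r s μ) := by
  intro hE
  obtain ⟨C, hC0, hC⟩ := hE.exists_real_bound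
  obtain ⟨K, hK, hKb⟩ := exists_varLpNorm_ball_le (𝕜 := ℝ) hp hP hD hμ h
  set e := (r⁻¹).toReal
  have he : 0 ≤ e := ENNReal.toReal_nonneg
  set k := (1 / q.toReal + Real.log 1) ^ (1 / q.toReal) with hk
  have hk0 : 0 ≤ k := by
    rw [hk, Real.log_one]
    positivity
  set l := Real.log 2 ^ (1 / s.toReal)
  have hl0 : 0 < l := Real.rpow_pos_of_pos (Real.log_pos one_lt_two) _
  refine not_forall_rpow_le_of_lt (A := (v / 2) ^ e * l) (B := C * (K * k)) (R := R)
    (a := D * e) (b := D / p x₀) (by positivity) hR ?_ fun ρ hρ hρR => ?_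
  · rw [div_eq_mul_one_div D]
    exact mul_lt_mul_of_pos_left hrp hD
  have hV : 0 < v * ρ ^ D := mul_pos hv (Real.rpow_pos_of_pos hρ _)
  set f := (Metric.ball x₀ ρ).indicator fun _ => (1 : 𝕜) with hf
  have hup : varLorentzNorm p q μ f ≤ ENNReal.ofReal (K * ρ ^ (D / p x₀) * k) := by
    have hf1 : ∀ x, ‖f x‖ ≤ 1 := fun x =>
      (norm_indicator_le_norm_self _ _).trans (norm_one (α := 𝕜)).le
    refine varLorentzNorm_le hp hq (by positivity) le_rfl hf1 fun u hu => ?_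
    rcases le_or_gt 1 u with h1 | h1
    · rw [levelNorm_eq_zero hp fun x => (hf1 x).trans h1, mul_zero]
      exact zero_le
    · rw [min_eq_left h1.le, mul_comm _ u, ENNReal.ofReal_mul hu.le]
      refine mul_le_mul_right ((levelNorm_le_of_subset hp fun x hx => ?_).trans (hKb ρ hρ hρR)) _
      by_contra hxb
      rw [mem_ofPred_eq, hf, indicator_of_notMem hxb, norm_zero] at hx
      exact absurd hx (not_lt.2 hu.le)
  have hlow : ENNReal.ofReal ((v * ρ ^ D / 2) ^ e * l) ≤ lorentzNorm r s μ f := by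
    have h2 : v * ρ ^ D / (v * ρ ^ D / 2) = 2 := by field_simp
    have := le_lorentzNorm (μ := μ) (f := f) (r := r) hs (A := (v * ρ ^ D / 2) ^ e)
      (a := v * ρ ^ D / 2) (b := v * ρ ^ D) (by positivity) (by positivity) (by linarith)
      fun t ht1 ht2 => ?_
    · rwa [h2] at this
    · have h3 : ENNReal.ofReal 1 ≤ rearrangement μ f t := by
        refine le_rearrangement fun σ hσ hσ1 => ?_
        refine lt_of_lt_of_le ?_ (measure_mono (s := Metric.ball x₀ ρ) fun x hx => ?_)
        · rw [hμ ρ hρ hρR]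
          exact (ENNReal.ofReal_lt_ofReal_iff hV).2 ht2
        · rw [mem_ofPred_eq, hf, indicator_of_mem hx, norm_one]
          exact hσ1
      rw [ENNReal.ofReal_one] at h3
      refine le_trans ?_ (le_mul_of_one_le_right' h3)
      rw [← ENNReal.ofReal_rpow_of_nonneg (by positivity) he]
      exact ENNReal.rpow_le_rpow (ENNReal.ofReal_le_ofReal ht1.le) he
  have h1 := hC f _ _ (measurable_indicator_ball x₀ ρ) (by positivity) hup hlow
  rw [mul_div_right_comm, Real.mul_rpow (by positivity) (by positivity),
    ← Real.rpow_mul hρ.le] at h1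
  linarith

end Local

/-! ### Truncated powers of the distance -/

section Truncated

variable {α : Type*} [PseudoMetricSpace α] {p : α → ℝ} {x₀ : α} {v D R C₀ δ κ : ℝ}
  {𝕜 : Type*} [RCLike 𝕜]

/-- The power `dist x x₀ ^ (-κ)`, cut off at distance `δ` from `x₀` and set to zero outside
the ball of radius `R`. -/
noncomputable def truncPow (𝕜 : Type*) [RCLike 𝕜] (x₀ : α) (κ R δ : ℝ) : α → 𝕜 :=
  (Metric.ball x₀ R).indicator fun x => ((max (dist x x₀) δ ^ (-κ) : ℝ) : 𝕜)

theorem norm_truncPow (hδ : 0 < δ) (x : α) :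
    ‖truncPow 𝕜 x₀ κ R δ x‖ = (Metric.ball x₀ R).indicator
      (fun x => max (dist x x₀) δ ^ (-κ)) x := by
  rw [truncPow, norm_indicator_eq_indicator_norm]
  congr 1
  ext x
  rw [RCLike.norm_ofReal, abs_of_pos (Real.rpow_pos_of_pos (lt_max_of_lt_right hδ) _)]

theorem norm_truncPow_le (hκ : 0 ≤ κ) (hδ : 0 < δ) (x : α) :
    ‖truncPow 𝕜 x₀ κ R δ x‖ ≤ δ ^ (-κ) := by
  rw [norm_truncPow hδ]
  refine indicator_apply_le' (fun _ => ?_) fun _ => (Real.rpow_pos_of_pos hδ _).le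
  exact Real.rpow_le_rpow_of_nonpos hδ (le_max_right _ _) (neg_nonpos.2 hκ)

theorem levelSet_truncPow_subset (hκ : 0 < κ) (hδ : 0 < δ) {u : ℝ} (hu : 0 < u) :
    {x | u < ‖truncPow 𝕜 x₀ κ R δ x‖} ⊆ Metric.ball x₀ (min R (u ^ (-κ⁻¹))) := by
  intro x hx
  rw [mem_ofPred_eq, norm_truncPow hδ] at hx
  by_cases hxb : x ∈ Metric.ball x₀ R
  · rw [indicator_of_mem hxb] at hx
    refine Metric.mem_ball.2 (lt_min hxb ((le_max_left _ δ).trans_lt ?_))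
    have hm : 0 < max (dist x x₀) δ := lt_max_of_lt_right hδ
    have := Real.rpow_lt_rpow_of_neg hu hx (neg_lt_zero.2 (inv_pos.2 hκ))
    rwa [← Real.rpow_mul hm.le, neg_mul_neg, mul_inv_cancel₀ hκ.ne', Real.rpow_one] at this
  · rw [indicator_of_notMem hxb] at hx
    exact absurd hx (not_lt.2 hu.le)

theorem ball_subset_levelSet_truncPow (hκ : 0 < κ) (hδ : 0 < δ) {u : ℝ} (hu : 0 < u)
    (hδu : δ < u ^ (-κ⁻¹)) :
    Metric.ball x₀ (min R (u ^ (-κ⁻¹))) ⊆ {x | u < ‖truncPow 𝕜 x₀ κ R δ x‖} := by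
  intro x hx
  have hx' := lt_min_iff.1 (Metric.mem_ball.1 hx)
  rw [mem_ofPred_eq, norm_truncPow hδ, indicator_of_mem (Metric.mem_ball.2 hx'.1)]
  have := Real.rpow_lt_rpow_of_neg (lt_max_of_lt_right hδ) (max_lt hx'.2 hδu) (neg_lt_zero.2 hκ)
  rwa [← Real.rpow_mul hu.le, neg_mul_neg, inv_mul_cancel₀ hκ.ne', Real.rpow_one] at this

/-- The radius `ρ = min R (u ^ (-κ⁻¹))` of a level set satisfies `u ρ ^ κ ≤ min u 1`. -/
theorem mul_min_rpow_le (hκ : 0 < κ) (hR : 0 < R) (hR1 : R ≤ 1) {u : ℝ} (hu : 0 < u) :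
    u * min R (u ^ (-κ⁻¹)) ^ κ ≤ min u 1 := by
  have hu' : 0 < u ^ (-κ⁻¹) := Real.rpow_pos_of_pos hu _
  have hm : 0 < min R (u ^ (-κ⁻¹)) := lt_min hR hu'
  refine le_min ?_ ?_
  · exact mul_le_of_le_one_right hu.le
      (Real.rpow_le_one hm.le ((min_le_left _ _).trans hR1) hκ.le)
  · refine (mul_le_mul_of_nonneg_left
      (Real.rpow_le_rpow hm.le (min_le_right _ _) hκ.le) hu.le).trans (le_of_eq ?_)
    rw [← Real.rpow_mul hu.le, neg_mul, inv_mul_cancel₀ hκ.ne', Real.rpow_neg_one,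
      mul_inv_cancel₀ hu.ne']

theorem one_le_rpow_neg (hκ : 0 ≤ κ) (hδ : 0 < δ) (hδ1 : δ ≤ 1) : 1 ≤ δ ^ (-κ) :=
  Real.one_le_rpow_of_pos_of_le_one_of_nonpos hδ hδ1 (neg_nonpos.2 hκ)

variable [MeasurableSpace α] {μ : Measure α}

/-- The rearrangement of the truncated power is `(v / t) ^ (κ / D)` between the volumes of the
balls of radii `δ` and `R`, so the integral defining the Lorentz quasi-norm is logarithmic. -/
theorem le_lorentzNorm_truncPow (hD : 0 < D) (hv : 0 < v) (hκ : 0 < κ) (hδ : 0 < δ) (hδR : δ < R)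
    (hμ : BallVolume μ x₀ v D R) {r s : ℝ≥0∞} (hs : 0 < s) (hr : (r⁻¹).toReal = κ / D) :
    ENNReal.ofReal (v ^ (κ / D) * (D * Real.log (R / δ)) ^ (1 / s.toReal)) ≤
      lorentzNorm r s μ (truncPow 𝕜 x₀ κ R δ) := by
  have hR : 0 < R := hδ.trans hδR
  have hlog : Real.log (v * R ^ D / (v * δ ^ D)) = D * Real.log (R / δ) := by
    rw [mul_div_mul_left _ _ hv.ne', ← Real.div_rpow hR.le hδ.le, Real.log_rpow (by positivity)]
  rw [← hlog]
  refine le_lorentzNorm hs (by positivity) (by positivity)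
    (mul_lt_mul_of_pos_left (Real.rpow_lt_rpow hδ.le hδR hD) hv) fun t ht1 ht2 => ?_
  have ht : 0 < t := (by positivity : 0 < v * δ ^ D).trans ht1
  -- `t` is the volume of the ball of radius `σ`.
  set σ := (t / v) ^ D⁻¹ with hσ
  have hσ0 : 0 < σ := Real.rpow_pos_of_pos (div_pos ht hv) _
  have htσ : t = v * σ ^ D := by
    rw [hσ, ← Real.rpow_mul (div_pos ht hv).le, inv_mul_cancel₀ hD.ne', Real.rpow_one,
      mul_div_cancel₀ _ hv.ne']
  rw [htσ] at ht1 ht2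
  have hδσ : δ < σ :=
    (Real.rpow_lt_rpow_iff hδ.le hσ0.le hD).1 (lt_of_mul_lt_mul_left ht1 hv.le)
  have hσR : σ < R :=
    (Real.rpow_lt_rpow_iff hσ0.le hR.le hD).1 (lt_of_mul_lt_mul_left ht2 hv.le)
  have hre : ENNReal.ofReal (σ ^ (-κ)) ≤ rearrangement μ (truncPow 𝕜 x₀ κ R δ) t := by
    refine le_rearrangement fun u hu huσ => ?_
    have hσu : σ < u ^ (-κ⁻¹) := by
      have := Real.rpow_lt_rpow_of_neg hu huσ (neg_lt_zero.2 (inv_pos.2 hκ))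
      rwa [← Real.rpow_mul hσ0.le, neg_mul_neg, mul_inv_cancel₀ hκ.ne', Real.rpow_one] at this
    have hm : σ < min R (u ^ (-κ⁻¹)) := lt_min hσR hσu
    refine lt_of_lt_of_le ?_
      (measure_mono (ball_subset_levelSet_truncPow hκ hδ hu (hδσ.trans hσu)))
    rw [hμ _ (hσ0.trans hm) (min_le_left _ _), htσ]
    have hm0 : 0 < min R (u ^ (-κ⁻¹)) ^ D := Real.rpow_pos_of_pos (hσ0.trans hm) _
    exact (ENNReal.ofReal_lt_ofReal_iff (mul_pos hv hm0)).2
      (mul_lt_mul_of_pos_left (Real.rpow_lt_rpow hσ0.le hm hD) hv)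
  refine le_trans (le_of_eq ?_) (mul_le_mul_right hre _)
  rw [hr, ENNReal.ofReal_rpow_of_nonneg ht.le (by positivity),
    ← ENNReal.ofReal_mul (by positivity), htσ, Real.mul_rpow hv.le (by positivity),
    ← Real.rpow_mul hσ0.le, mul_div_cancel₀ _ hD.ne', mul_assoc, ← Real.rpow_add hσ0,
    add_neg_cancel, Real.rpow_zero, mul_one]

variable [OpensMeasurableSpace α]

theorem measurable_truncPow (𝕜 : Type*) [RCLike 𝕜] (x₀ : α) (κ R δ : ℝ) :
    Measurable (truncPow 𝕜 x₀ κ R δ) := by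
  refine Measurable.indicator ?_ Metric.isOpen_ball.measurableSet
  refine RCLike.measurable_ofReal.comp ?_
  exact ((((continuous_id.dist continuous_const).max continuous_const).measurable).pow_const _)

theorem exists_varLorentzNorm_truncPow_le (hp : ∀ x, 0 < p x) (hP : ∀ᵐ x ∂μ, p x₀ ≤ p x)
    (hD : 0 < D) (hR : 0 < R) (hR1 : R ≤ 1) (hμ : BallVolume μ x₀ v D R)
    (h : LogOscillation p x₀ C₀ R) {q : ℝ≥0∞} (hq : 0 < q) :
    ∃ K : ℝ, 0 < K ∧ ∀ δ, 0 < δ → δ < R →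
      varLorentzNorm p q μ (truncPow 𝕜 x₀ (D / p x₀) R δ) ≤
        ENNReal.ofReal (K * (1 / q.toReal + Real.log (δ ^ (-(D / p x₀)))) ^ (1 / q.toReal)) := by
  obtain ⟨K, hK, hKb⟩ := exists_varLpNorm_ball_le (𝕜 := ℝ) hp hP hD hμ h
  have hκ : 0 < D / p x₀ := div_pos hD (hp x₀)
  refine ⟨K, hK, fun δ hδ hδR => ?_⟩
  refine varLorentzNorm_le hp hq hK.le (one_le_rpow_neg hκ.le hδ (hδR.le.trans hR1))
    (norm_truncPow_le hκ.le hδ) fun u hu => ?_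
  have hm : 0 < min R (u ^ (-(D / p x₀)⁻¹)) := lt_min hR (Real.rpow_pos_of_pos hu _)
  refine (mul_le_mul_right ((levelNorm_le_of_subset hp (levelSet_truncPow_subset hκ hδ hu)).trans
    (hKb _ hm (min_le_left _ _))) _).trans ?_
  rw [← ENNReal.ofReal_mul hu.le]
  refine ENNReal.ofReal_le_ofReal ?_
  rw [mul_left_comm]
  exact mul_le_mul_of_nonneg_left (mul_min_rpow_le hκ hR hR1 hu) hK.le

/-- The layer-cake formula bounds the integral of the truncated power with the critical
exponent `D`. -/
theorem lintegral_truncPow_le (hD : 0 < D) (hv : 0 < v) (hR : 0 < R) (hR1 : R ≤ 1) (hδ : 0 < δ)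
    (hδR : δ < R) (hμ : BallVolume μ x₀ v D R) :
    ∫⁻ x, ‖truncPow ℝ x₀ D R δ x‖ₑ ∂μ ≤ ENNReal.ofReal (v * (1 + Real.log (δ ^ (-D)))) := by
  simp_rw [← ofReal_norm]
  rw [lintegral_eq_lintegral_meas_lt μ (Filter.Eventually.of_forall fun _ => norm_nonneg _)
    (measurable_truncPow ℝ x₀ D R δ).norm.aemeasurable]
  have key := lintegral_rpow_div_le (q := 1) (A := v) (N := δ ^ (-D))
    (F := fun t => ENNReal.ofReal t * μ {x | t < ‖truncPow ℝ x₀ D R δ x‖}) one_pos hv.le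
    (one_le_rpow_neg hD.le hδ (hδR.le.trans hR1)) (fun t ht => ?_) fun t ht => ?_
  · rw [Real.rpow_one, div_one] at key
    refine le_trans (le_of_eq (setLIntegral_congr_fun measurableSet_Ioi fun t ht => ?_)) key
    have ht0 : ENNReal.ofReal t ≠ 0 := by simpa using ht
    simp only [ENNReal.rpow_one]
    rw [mul_comm, mul_div_assoc, ENNReal.div_self ht0 ENNReal.ofReal_ne_top, mul_one]
  · have hm : 0 < min R (t ^ (-D⁻¹)) := lt_min hR (Real.rpow_pos_of_pos ht _)
    refine (mul_le_mul_right (measure_mono (levelSet_truncPow_subset hD hδ ht)) _).trans ?_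
    rw [hμ _ hm (min_le_left _ _), ← ENNReal.ofReal_mul ht.le]
    refine ENNReal.ofReal_le_ofReal ?_
    rw [mul_left_comm]
    exact mul_le_mul_of_nonneg_left (mul_min_rpow_le hD hR hR1 ht) hv.le
  · have : {x | t < ‖truncPow ℝ x₀ D R δ x‖} = ∅ := by
      ext x
      simpa using (norm_truncPow_le (𝕜 := ℝ) hD.le hδ x).trans ht
    rw [this, measure_empty, mul_zero]

/-- Log-Hölder continuity turns `f ^ p`, for the truncated power `f` of exponent `D / p x₀`, into
the truncated power of exponent `D`, up to a constant. -/
theorem exists_varLpNorm_truncPow_le (hp : ∀ x, 0 < p x) (hP : ∀ᵐ x ∂μ, p x₀ ≤ p x)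
    (hD : 0 < D) (hv : 0 < v) (hR : 0 < R) (hR1 : R ≤ 1) (hμ : BallVolume μ x₀ v D R)
    (h : LogOscillation p x₀ C₀ R) :
    ∃ K : ℝ, 0 < K ∧ ∀ δ, 0 < δ → δ < R →
      varLpNorm p μ (truncPow 𝕜 x₀ (D / p x₀) R δ) ≤
        ENNReal.ofReal (K * (1 + Real.log (δ ^ (-D))) ^ (1 / p x₀)) := by
  have hP0 := hp x₀
  have hκ : 0 < D / p x₀ := div_pos hD hP0
  set E := Real.exp (D / p x₀ * C₀)
  have hE : 0 < E := Real.exp_pos _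
  set M : ℝ := max 1 (E * v)
  have hM1 : 1 ≤ M := le_max_left _ _
  have hM0 : 0 < M := zero_lt_one.trans_le hM1
  refine ⟨M ^ (1 / p x₀), Real.rpow_pos_of_pos hM0 _, fun δ hδ hδR => ?_⟩
  set L := 1 + Real.log (δ ^ (-D)) with hL
  have hL1 : 1 ≤ L := by
    rw [hL, le_add_iff_nonneg_right]
    exact Real.log_nonneg (one_le_rpow_neg hD.le hδ (hδR.le.trans hR1))
  have hL0 : 0 < L := zero_lt_one.trans_le hL1
  have hML : 1 ≤ M * L := one_le_mul_of_one_le_of_one_le hM1 hL1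
  rw [← Real.mul_rpow hM0.le hL0.le]
  set c := (M * L) ^ (1 / p x₀) with hc
  have hc0 : 0 < c := Real.rpow_pos_of_pos (mul_pos hM0 hL0) _
  refine varLpNorm_le hc0 ?_
  have hint : ∀ᵐ x ∂μ, ‖(c⁻¹ • truncPow 𝕜 x₀ (D / p x₀) R δ) x‖ₑ ^ p x ≤
      ENNReal.ofReal ((M * L)⁻¹ * E) * ‖truncPow ℝ x₀ D R δ x‖ₑ := by
    filter_upwards [hP] with x hx
    have hnn : 0 ≤ (Metric.ball x₀ R).indicator (fun x => max (dist x x₀) δ ^ (-(D / p x₀))) x :=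
      indicator_apply_nonneg fun _ => Real.rpow_nonneg (hδ.le.trans (le_max_right _ _)) _
    rw [Pi.smul_apply, ← ofReal_norm, ← ofReal_norm, norm_smul,
      norm_truncPow hδ, norm_truncPow hδ, ENNReal.ofReal_rpow_of_nonneg
        (mul_nonneg (norm_nonneg _) hnn) (hp x).le, ← ENNReal.ofReal_mul (by positivity)]
    refine ENNReal.ofReal_le_ofReal ?_
    by_cases hxb : x ∈ Metric.ball x₀ R
    · have hm : 0 < max (dist x x₀) δ := lt_max_of_lt_right hδ
      rw [indicator_of_mem hxb, indicator_of_mem hxb, Real.norm_of_nonneg (inv_pos.2 hc0).le,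
        Real.mul_rpow (inv_pos.2 hc0).le (Real.rpow_nonneg hm.le _), mul_assoc]
      refine mul_le_mul ?_ ?_ (by positivity) (by positivity)
      · rw [hc, ← Real.rpow_neg (mul_pos hM0 hL0).le, ← Real.rpow_mul (mul_pos hM0 hL0).le,
          ← Real.rpow_neg_one (M * L)]
        refine Real.rpow_le_rpow_of_exponent_le hML ?_
        rw [neg_mul, neg_le_neg_iff, one_div, inv_mul_eq_div, one_le_div hP0]
        exact hx
      · have := h.rpow_le hm (max_le (Metric.mem_ball.1 hxb).le hδR.le) hκ.le (le_max_left _ _)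
        rw [← Real.rpow_mul hm.le]
        refine this.trans (le_of_eq ?_)
        rw [neg_mul, div_mul_cancel₀ _ hP0.ne']
    · rw [indicator_of_notMem hxb, indicator_of_notMem hxb, mul_zero, mul_zero,
        Real.zero_rpow (hp x).ne']
  refine (lintegral_mono_ae hint).trans ?_
  rw [lintegral_const_mul' _ _ ENNReal.ofReal_ne_top]
  refine (mul_le_mul_right (lintegral_truncPow_le hD hv hR hR1 hδ hδR hμ) _).trans ?_
  rw [← ENNReal.ofReal_mul (by positivity), ENNReal.ofReal_le_one, mul_assoc,
    inv_mul_le_one₀ (mul_pos hM0 hL0), ← mul_assoc]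
  exact mul_le_mul_of_nonneg_right (le_max_right _ _) hL0.le

/-! ### Failure of the embeddings with the critical first index -/

/-- If the quasi-norm `N` of the truncated power of critical exponent grows at most like the power
`β` of the logarithm of `1 / δ`, then `N` does not control the Lorentz quasi-norm of critical
first index and second index `s < 1 / β`. -/
theorem not_embeds_lorentzNorm_of_log_growth (hP0 : 0 < p x₀) (hD : 0 < D) (hv : 0 < v)
    (hR : 0 < R) (hR1 : R ≤ 1) (hμ : BallVolume μ x₀ v D R) {N : (α → 𝕜) → ℝ≥0∞}
    {K c k β : ℝ} (hK : 0 < K) (hc : 0 ≤ c) (hk : 0 ≤ k) (hβ : 0 ≤ β)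
    (hN : ∀ δ, 0 < δ → δ < R → N (truncPow 𝕜 x₀ (D / p x₀) R δ) ≤
      ENNReal.ofReal (K * (c + Real.log (δ ^ (-k))) ^ β))
    {r s : ℝ≥0∞} (hs : 0 < s) (hr : (r⁻¹).toReal = 1 / p x₀) (hβs : β < 1 / s.toReal) :
    ¬ Embeds (𝕜 := 𝕜) N (lorentzNorm r s μ) := by
  intro hE
  obtain ⟨C, hC0, hC⟩ := hE.exists_real_bound
  have hκ : 0 < D / p x₀ := div_pos hD hP0
  have hRl : 0 ≤ -Real.log R := neg_nonneg.2 (Real.log_nonpos hR.le hR1)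
  refine not_forall_rpow_le_affine_rpow (A := v ^ (D / p x₀ / D)) (B := C * K)
    (c := c + k * -Real.log R) (k := k / D) (y₀ := 1) (Real.rpow_pos_of_pos hv _)
    (mul_nonneg hC0 hK.le) (by positivity) (by positivity) hβ hβs fun y hy => ?_
  -- The cut-off `δ` is chosen so that `D * log (R / δ) = y`.
  set δ := R * Real.exp (-(y / D)) with hδ
  have hδ0 : 0 < δ := mul_pos hR (Real.exp_pos _)
  have hy0 : 0 < y := zero_lt_one.trans_le hy
  have hδR : δ < R := mul_lt_of_lt_one_right hR
    (Real.exp_lt_one_iff.2 (neg_lt_zero.2 (div_pos hy0 hD)))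
  have hlδ : Real.log δ = Real.log R - y / D := by
    rw [hδ, Real.log_mul hR.ne' (Real.exp_pos _).ne', Real.log_exp, sub_eq_add_neg]
  have hl1 : D * Real.log (R / δ) = y := by
    rw [Real.log_div hR.ne' hδ0.ne', hlδ, sub_sub_cancel, mul_div_cancel₀ _ hD.ne']
  have hl2 : c + Real.log (δ ^ (-k)) = c + k * -Real.log R + k / D * y := by
    rw [Real.log_rpow hδ0, hlδ]
    ring
  have hlow := le_lorentzNorm_truncPow (𝕜 := 𝕜) hD hv hκ hδ0 hδR hμ (r := r) hs
    (by rw [hr]; field_simp)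
  have hup := hN δ hδ0 hδR
  rw [hl1] at hlow
  rw [hl2] at hup
  have := hC _ _ _ (measurable_truncPow 𝕜 x₀ _ R δ) (by positivity) hup hlow
  rwa [← mul_assoc] at this

end Truncated

/-! ### The case of Lebesgue measure -/

theorem exists_ballVolume_lebesgue {d : ℕ} (hd : 0 < d) {Ω : Set (EuclideanSpace ℝ (Fin d))}
    (hΩ : IsOpen Ω) (x₀ : Ω) :
    ∃ v R : ℝ, 0 < v ∧ 0 < R ∧ R < 1 / 2 ∧ BallVolume (lebesgue Ω) x₀ v d R := by
  obtain ⟨ε, hε, hball⟩ := Metric.isOpen_iff.1 hΩ x₀ x₀.2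
  have : Nonempty (Fin d) := ⟨⟨0, hd⟩⟩
  have hv : 0 < volume (Metric.ball (0 : EuclideanSpace ℝ (Fin d)) 1) :=
    Metric.measure_ball_pos _ _ one_pos
  have hv' : volume (Metric.ball (0 : EuclideanSpace ℝ (Fin d)) 1) ≠ ∞ := measure_ball_lt_top.ne
  refine ⟨_, min ε (1 / 4), ENNReal.toReal_pos hv.ne' hv', lt_min hε (by norm_num),
    (min_le_right _ _).trans_lt (by norm_num), fun ρ hρ hρR => ?_⟩
  have himg : Subtype.val '' Metric.ball x₀ ρ = Metric.ball (x₀ : EuclideanSpace ℝ (Fin d)) ρ := by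
    ext x
    constructor
    · rintro ⟨y, hy, rfl⟩
      exact hy
    · intro hx
      exact ⟨⟨x, hball (Metric.ball_subset_ball (hρR.trans (min_le_left _ _)) hx)⟩, hx, rfl⟩
  rw [lebesgue, (MeasurableEmbedding.subtype_coe hΩ.measurableSet).comap_apply, himg,
    Measure.addHaar_ball _ _ hρ.le, finrank_euclideanSpace_fin, mul_comm,
    ENNReal.ofReal_mul ENNReal.toReal_nonneg, ENNReal.ofReal_toReal hv', Real.rpow_natCast]

end VarLorentz

theorem mainTheorem11 {𝕜 : Type*} [RCLike 𝕜] {d : ℕ} (hd : 0 < d)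
    (Ω : Set (EuclideanSpace ℝ (Fin d))) (hΩ : IsOpen Ω)
    (p : Ω → ℝ) (hp : VarLorentz.IsExponent p (VarLorentz.lebesgue Ω))
    (hp_fin : VarLorentz.pPlus p (VarLorentz.lebesgue Ω) < ∞)
    (x₀ : Ω) (hx₀ : ENNReal.ofReal (p x₀) = VarLorentz.pMinus p (VarLorentz.lebesgue Ω)) :
    (VarLorentz.LogHolder p →
      ∀ r : ℝ≥0∞, VarLorentz.pMinus p (VarLorentz.lebesgue Ω) < r →
        ¬ VarLorentz.Embeds (𝕜 := 𝕜) (VarLorentz.varLpNorm p (VarLorentz.lebesgue Ω))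
            (fun f => eLpNorm f r (VarLorentz.lebesgue Ω)) ∧
        ∀ q s : ℝ≥0∞, 0 < q → 0 < s →
          ¬ VarLorentz.Embeds (𝕜 := 𝕜) (VarLorentz.varLorentzNorm p q (VarLorentz.lebesgue Ω))
              (VarLorentz.lorentzNorm r s (VarLorentz.lebesgue Ω))) ∧
    (volume Ω < ∞ → VarLorentz.LogHolderAt p x₀ →
      (1 < VarLorentz.pMinus p (VarLorentz.lebesgue Ω) →
        ∀ s : ℝ≥0∞, 0 < s → s < VarLorentz.pMinus p (VarLorentz.lebesgue Ω) →
          ¬ VarLorentz.Embeds (𝕜 := 𝕜) (VarLorentz.varLpNorm p (VarLorentz.lebesgue Ω))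
              (VarLorentz.lorentzNorm (VarLorentz.pMinus p (VarLorentz.lebesgue Ω)) s (VarLorentz.lebesgue Ω))) ∧
      (∀ q : ℝ≥0∞, 1 < q → ∀ u : ℝ≥0∞, 0 < u → u < q →
          ¬ VarLorentz.Embeds (𝕜 := 𝕜) (VarLorentz.varLorentzNorm p q (VarLorentz.lebesgue Ω))
              (VarLorentz.lorentzNorm (VarLorentz.pMinus p (VarLorentz.lebesgue Ω)) u (VarLorentz.lebesgue Ω)))) := by
  obtain ⟨v, R, hv, hR, hR2, hμ⟩ := VarLorentz.exists_ballVolume_lebesgue hd hΩ x₀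
  have hR1 : R ≤ 1 := by linarith
  have hD : (0 : ℝ) < d := Nat.cast_pos.2 hd
  have hP0 : 0 < p x₀ := hp.pos x₀
  have hP : ∀ᵐ x ∂VarLorentz.lebesgue Ω, p x₀ ≤ p x := by
    have : ∀ᵐ x ∂VarLorentz.lebesgue Ω,
        VarLorentz.pMinus p (VarLorentz.lebesgue Ω) ≤ ENNReal.ofReal (p x) := ae_essInf_le
    filter_upwards [this] with x hx
    rw [← hx₀] at hx
    exact (ENNReal.ofReal_le_ofReal_iff (hp.pos x).le).1 hx
  have hinv : ((ENNReal.ofReal (p x₀))⁻¹).toReal = 1 / p x₀ := by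
    rw [ENNReal.toReal_inv, ENNReal.toReal_ofReal hP0.le, one_div]
  rw [← hx₀]
  refine ⟨fun hlh r hr => ?_, fun _ hlh => ⟨fun _ s hs hsp => ?_, fun q hq u hu huq => ?_⟩⟩
  · obtain ⟨C₀, h⟩ := (hlh x₀).exists_logOscillation
    have hri : (r⁻¹).toReal < 1 / p x₀ := by
      rw [← hinv]
      exact (ENNReal.toReal_lt_toReal (by simpa using ne_bot_of_gt hr) (by simpa using hP0)).2
        (ENNReal.inv_lt_inv.2 hr)
    refine ⟨VarLorentz.not_embeds_eLpNorm hp.pos hP hD hv hR hμ (h R hR2) (ne_bot_of_gt hr) ?_,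
      fun q s hq hs => VarLorentz.not_embeds_lorentzNorm_of_lt hp.pos hP hD hv hR hμ (h R hR2)
        hq hs hri⟩
    rwa [one_div, ← ENNReal.toReal_inv]
  · obtain ⟨C₀, h⟩ := hlh.exists_logOscillation
    obtain ⟨K, hK, hKb⟩ := VarLorentz.exists_varLpNorm_truncPow_le (𝕜 := 𝕜) hp.pos hP hD hv hR hR1
      hμ (h R hR2)
    refine VarLorentz.not_embeds_lorentzNorm_of_log_growth hP0 hD hv hR hR1 hμ hK zero_le_one hD.le
      (by positivity) hKb hs hinv ?_
    have hs' : 0 < s.toReal := ENNReal.toReal_pos hs.ne' (hsp.trans ENNReal.ofReal_lt_top).ne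
    refine one_div_lt_one_div_of_lt hs' ?_
    rwa [← ENNReal.lt_ofReal_iff_toReal_lt (hsp.trans ENNReal.ofReal_lt_top).ne]
  · obtain ⟨C₀, h⟩ := hlh.exists_logOscillation
    have hq0 : 0 < q := hu.trans huq
    obtain ⟨K, hK, hKb⟩ := VarLorentz.exists_varLorentzNorm_truncPow_le (𝕜 := 𝕜) hp.pos hP hD hR
      hR1 hμ (h R hR2) hq0
    refine VarLorentz.not_embeds_lorentzNorm_of_log_growth hP0 hD hv hR hR1 hμ hK (by positivity)
      (by positivity) (by positivity) hKb hu hinv ?_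
    rw [one_div, one_div, ← ENNReal.toReal_inv, ← ENNReal.toReal_inv]
    exact (ENNReal.toReal_lt_toReal (by simpa using hq0.ne') (by simpa using hu.ne')).2
      (ENNReal.inv_lt_inv.2 huq)
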